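/- Let $G$ be a finite simple graph and let $p\in[0,1]$. Let $G\square K_2$ be the Cartesian product of $G$ with the complete graph on $\{0,1\}$: its vertices are $v=(v,0)$ and $v'=(v,1)$ for $v\in V(G)$, and its edges are $\{u,w\}$ and $\{u',w'\}$ for every edge $\{u,w\}$ of $G$, together with the outside edges $\{v,v'\}$ for every $v\in V(G)$. Retain each edge of $G\square K_2$ with probability $p$ and remove it otherwise, independently of all other edges, and let $X\subseteq V(G)$ be the random set of those vertices $v$ whose outside edge $\{v,v'\}$ is retained. Write $a\leftrightarrow b$ for the event that $a$ and $b$ are joined by a path of retained edges. Then for all $s,f\in V(G)$: (i) for every set $X_0\subseteq V(G)$ with $|X_0|=2$ and $P(X=X_0)>0$, $$P(s\leftrightarrow f\mid X=X_0)\ \ge\ P(s\leftrightarrow f'\mid X=X_0);$$ (ii) if $P(|X|=2)>0$, then $$P(s\leftrightarrow f\mid |X|=2)\ \ge\ P(s\leftrightarrow f'\mid |X|=2).$$ -/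

import Mathlib

namespace BunkBed

open MeasureTheory ProbabilityTheory

/-- The bunk bed graph `G □ K₂`; the vertices `v` and `v'` are `(v, 0)` and `(v, 1)`. -/
def graph {V : Type*} (G : SimpleGraph V) : SimpleGraph (V × Fin 2) :=
  SimpleGraph.boxProd G (⊤ : SimpleGraph (Fin 2))

/-- The law of the random set of retained edges: every edge of `G □ K₂` is retained with
probability `p` (removed with probability `1 - p`), independently of the others. -/
noncomputable def percolation {V : Type*} (G : SimpleGraph V) (p : unitInterval) :
    Measure (Set (Sym2 (V × Fin 2))) :=
  setBernoulli (graph G).edgeSet p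

/-- The event that `a` and `b` are joined by a path of retained edges. -/
def connected {V : Type*} (a b : V × Fin 2) : Set (Set (Sym2 (V × Fin 2))) :=
  {ω | (SimpleGraph.fromEdgeSet ω).Reachable a b}

/-- The set of the vertices `v` of `G` whose outside edge `{v, v'}` is retained
in the configuration `ω`. -/
def outside {V : Type*} (ω : Set (Sym2 (V × Fin 2))) : Set V :=
  {v | s((v, 0), (v, 1)) ∈ ω}

end BunkBed

/-! Fix the outside edges as those over `x` and `y`; the layers are then independent percolations
`a` and `b` on `G`. Let `N` say that `x` and `y` are separated within a layer. A path from `s` to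
`f'` forces one of `x`, `y` to be joined to `s` in `a` and to `f` in `b`. Conversely, `s` reaches
`f` if it does so in `a`, or if `s` and `f` hang in `a` on different ones of `x`, `y` and `b` joins
`x` to `y`.

Write `S`, `F` for the events that `s`, `f` are joined to `{x, y}` in one layer. Discarding the
cases where `s` and `f` hang on different ends gives P(s ↔ f') ≤ P(S) P(F) - P(N, x~s) P(N, y~f) -
P(N, y~s) P(N, x~f). Harris' inequality (`prob_joined_mul_le`) bounds P(S) P(F) by P(S, F) in a
single layer. Negative correlation given separation (`prob_separated_mul_le`) bounds each subtracted
product below by P(N) times a joint probability. What remains is at most P(s~f in a) + (P(N, x~s,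
y~f) + P(N, x~f, y~s)) (1 - P(N)), a lower bound for P(s ↔ f), since 1 - P(N) is the chance that `b`
joins `x` to `y`. This is `two_layers_le`.

The correlation inequalities come from exploring a cluster edge by edge: a retained edge adds its
far end to the explored set, a removed one disappears, and `mixture_correlation` combines the two
cases. -/

namespace BunkBed

open Finset MeasureTheory ProbabilityTheory

/-! ### Bernoulli means over the subsets of a finite set -/

section Mean

variable {α β : Type*} [DecidableEq α] [DecidableEq β]

/-- The mean of `φ ω`, where `ω` is the random subset of `E` that contains each element
with probability `p`, independently of the others. -/
def mean (p : ℝ) (E : Finset α) (φ : Finset α → ℝ) : ℝ :=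
  ∑ ω ∈ E.powerset, p ^ #ω * (1 - p) ^ #(E \ ω) * φ ω

variable {p : ℝ} {E F : Finset α} {φ ψ : Finset α → ℝ}

@[simp] lemma mean_empty : mean p ∅ φ = φ ∅ := by simp [mean]

lemma mean_insert {e : α} (he : e ∉ E) :
    mean p (insert e E) φ =
      p * mean p E (fun ω => φ (insert e ω)) + (1 - p) * mean p E φ := by
  simp only [mean, mul_sum]
  rw [sum_powerset_insert he, add_comm]
  congr 1 <;> refine sum_congr rfl fun ω hω => ?_
  · have heω : e ∉ ω := fun h => he (mem_powerset.1 hω h)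
    have h : insert e E \ insert e ω = E \ ω := by grind
    rw [h, card_insert_of_notMem heω]
    ring
  · have heω : e ∉ ω := fun h => he (mem_powerset.1 hω h)
    rw [insert_sdiff_of_notMem _ heω, card_insert_of_notMem (by simp [he])]
    ring

lemma mean_erase {e : α} (he : e ∈ E) :
    mean p E φ =
      p * mean p (E.erase e) (fun ω => φ (insert e ω)) + (1 - p) * mean p (E.erase e) φ := by
  conv_lhs => rw [← insert_erase he]
  exact mean_insert (notMem_erase e E)

lemma mean_add : mean p E (fun ω => φ ω + ψ ω) = mean p E φ + mean p E ψ := by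
  simp [mean, mul_add, sum_add_distrib]

lemma mean_sub : mean p E (fun ω => φ ω - ψ ω) = mean p E φ - mean p E ψ := by
  simp [mean, mul_sub, sum_sub_distrib]

lemma mean_mul_left (c : ℝ) : mean p E (fun ω => c * φ ω) = c * mean p E φ := by
  simp only [mean, mul_sum]
  exact sum_congr rfl fun ω _ => by ring

lemma mean_mul_right (c : ℝ) : mean p E (fun ω => φ ω * c) = mean p E φ * c := by
  simp only [mean, sum_mul]
  exact sum_congr rfl fun ω _ => by ring

lemma mean_const (c : ℝ) : mean p E (fun _ => c) = c := by
  induction E using Finset.induction_on with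
  | empty => simp
  | insert e E he ih => rw [mean_insert he, ih]; ring

lemma mean_congr (h : ∀ ω ⊆ E, φ ω = ψ ω) : mean p E φ = mean p E ψ :=
  sum_congr rfl fun ω hω => by rw [h ω (mem_powerset.1 hω)]

lemma mean_mono (hp : p ∈ Set.Icc (0 : ℝ) 1) (h : ∀ ω ⊆ E, φ ω ≤ ψ ω) :
    mean p E φ ≤ mean p E ψ := by
  refine sum_le_sum fun ω hω => ?_
  have h0 := hp.1
  have h1 : 0 ≤ 1 - p := sub_nonneg.2 hp.2
  exact mul_le_mul_of_nonneg_left (h ω (mem_powerset.1 hω)) (by positivity)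

lemma mean_nonneg (hp : p ∈ Set.Icc (0 : ℝ) 1) (h : ∀ ω ⊆ E, 0 ≤ φ ω) : 0 ≤ mean p E φ := by
  simpa only [mean_const] using mean_mono (φ := fun _ => 0) hp h

lemma mean_union (h : Disjoint E F) :
    mean p (E ∪ F) φ = mean p E (fun a => mean p F (fun b => φ (a ∪ b))) := by
  induction E using Finset.induction_on generalizing φ with
  | empty => simp
  | insert e E he ih =>
    rw [disjoint_insert_left] at h
    rw [insert_union, mean_insert (by simp [he, h.1]), mean_insert he, ih h.2, ih h.2]
    simp only [insert_union]

lemma mean_image {g : α → β} (hg : g.Injective) {φ : Finset β → ℝ} :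
    mean p (E.image g) φ = mean p E (fun ω => φ (ω.image g)) := by
  induction E using Finset.induction_on generalizing φ with
  | empty => simp
  | insert e E he ih =>
    rw [image_insert, mean_insert (by simpa [hg.eq_iff] using he), mean_insert he, ih, ih]
    simp only [image_insert]

end Mean

/-! ### Connection to a set of vertices -/

section Joined

variable {V : Type*} {ω : Set (Sym2 V)} {X Y : Set V} {u v w : V}

/-- The edges of `ω` connect `v` with some vertex of `X`. -/
def Joined (ω : Set (Sym2 V)) (X : Set V) (v : V) : Prop :=
  ∃ x ∈ X, (SimpleGraph.fromEdgeSet ω).Reachable x v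

/-- The edges of `ω` connect no vertex of `X` with a vertex of `Y`. -/
def Separated (ω : Set (Sym2 V)) (X Y : Set V) : Prop :=
  ∀ y ∈ Y, ¬ Joined ω X y

lemma joined_of_mem (h : v ∈ X) : Joined ω X v := ⟨v, h, .rfl⟩

lemma Joined.trans (h : Joined ω X v) (hw : (SimpleGraph.fromEdgeSet ω).Reachable v w) :
    Joined ω X w := let ⟨x, hx, hr⟩ := h; ⟨x, hx, hr.trans hw⟩

lemma joined_singleton : Joined ω {u} v ↔ (SimpleGraph.fromEdgeSet ω).Reachable u v := by
  simp [Joined]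

lemma joined_pair :
    Joined ω {u, w} v ↔ (SimpleGraph.fromEdgeSet ω).Reachable u v ∨
      (SimpleGraph.fromEdgeSet ω).Reachable w v := by
  simp [Joined]

lemma joined_insert : Joined ω (insert w X) v ↔
    (SimpleGraph.fromEdgeSet ω).Reachable w v ∨ Joined ω X v := by
  simp [Joined]

lemma Separated.symm (h : Separated ω X Y) : Separated ω Y X :=
  fun x hx ⟨y, hy, hr⟩ => h y hy ⟨x, hx, hr.symm⟩

lemma separated_comm : Separated ω X Y ↔ Separated ω Y X := ⟨.symm, .symm⟩

lemma separated_insert : Separated ω (insert v X) Y ↔ Separated ω X Y ∧ ¬ Joined ω Y v := by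
  rw [separated_comm, separated_comm (X := X)]
  simp [Separated, and_comm]

/-- A predicate that holds on `X` and passes along edges holds wherever `X` reaches. -/
lemma Joined.induct {P : V → Prop} (h : Joined ω X v) (h0 : ∀ x ∈ X, P x)
    (h1 : ∀ a b, P a → s(a, b) ∈ ω → P b) : P v := by
  obtain ⟨x, hx, ⟨q⟩⟩ := h
  have hPx := h0 x hx
  clear h0 hx
  induction q with
  | nil => exact hPx
  | cons hadj _ ih => exact ih (h1 _ _ hPx (by simpa using hadj.1))

lemma Joined.step (h : Joined ω X u) (he : s(u, v) ∈ ω) : Joined ω X v := by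
  rcases eq_or_ne u v with rfl | hne
  · exact h
  · exact h.trans (SimpleGraph.Adj.reachable (by simp [he, hne]))

lemma Joined.mono {ω' : Set (Sym2 V)} (h : Joined ω X v) (hω : ω ⊆ ω') : Joined ω' X v :=
  h.induct (fun _ => joined_of_mem) fun _ _ ha he => ha.step (hω he)

/-- The exploration step: retaining an edge at `X` has the same effect as adding its other end to
`X`, so an induction that deletes this edge must let `X` vary. -/
lemma joined_insert_edge (hu : u ∈ X) :
    Joined (insert s(u, v) ω) X w ↔ Joined ω (insert v X) w := by
  constructor <;> intro h
  · refine h.induct (fun x hx => joined_of_mem (by simp [hx])) fun a b ha he => ?_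
    rcases he with he | he
    · rcases Sym2.eq_iff.1 he with ⟨rfl, rfl⟩ | ⟨rfl, rfl⟩
      · exact joined_of_mem (by simp)
      · exact joined_of_mem (by simp [hu])
    · exact ha.step he
  · refine h.induct (fun x hx => ?_) fun a b ha he => ha.step (by simp [he])
    rcases hx with rfl | hx
    · exact (joined_of_mem hu).step (by simp)
    · exact joined_of_mem hx

lemma separated_insert_edge (hu : u ∈ X) :
    Separated (insert s(u, v) ω) X Y ↔ Separated ω (insert v X) Y := by
  simp [Separated, joined_insert_edge hu]

/-- Both ends of the new edge lie outside the cluster of `Y`, so the edge cannot enlarge it. -/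
lemma joined_insert_edge_of_separated (hu : u ∈ X) (h : Separated ω (insert v X) Y) :
    Joined (insert s(u, v) ω) Y w ↔ Joined ω Y w := by
  refine ⟨fun hw => hw.induct (fun x => joined_of_mem) fun a b ha he => ?_,
    fun hw => hw.mono (Set.subset_insert _ _)⟩
  rcases he with he | he
  · have hs := h.symm
    rcases Sym2.eq_iff.1 he with ⟨rfl, rfl⟩ | ⟨rfl, rfl⟩
    · exact absurd ha (hs _ (by simp [hu]))
    · exact absurd ha (hs _ (by simp))
  · exact ha.step he

lemma separated_joined_insert_edge (hu : u ∈ X) (P : (V → Prop) → Prop) :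
    (Separated (insert s(u, v) ω) X Y ∧ P (Joined (insert s(u, v) ω) Y)) ↔
      Separated ω (insert v X) Y ∧ P (Joined ω Y) := by
  rw [separated_insert_edge hu]
  refine and_congr_right fun h => ?_
  rw [show Joined (insert s(u, v) ω) Y = Joined ω Y from
    funext fun w => propext (joined_insert_edge_of_separated hu h)]

/-- If no edge touches `X`, then `X` reaches only its own vertices. -/
lemma joined_iff_mem (h : ∀ a ∈ X, ∀ b, s(a, b) ∉ ω) : Joined ω X v ↔ v ∈ X :=
  ⟨fun hv => hv.induct (fun _ => id) fun a b ha he => absurd he (h a ha b), joined_of_mem⟩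

end Joined

/-! ### Correlation of connection events -/

section Correlation

variable {V : Type*} [DecidableEq V] {p : ℝ}

open Classical in
/-- The indicator of a proposition. -/
noncomputable def ind (P : Prop) : ℝ := if P then 1 else 0

@[simp] lemma ind_true : ind True = 1 := if_pos trivial

@[simp] lemma ind_false : ind False = 0 := if_neg id

lemma ind_nonneg (P : Prop) : 0 ≤ ind P := by by_cases h : P <;> simp [h]

lemma ind_le_one (P : Prop) : ind P ≤ 1 := by by_cases h : P <;> simp [h]

lemma ind_mono {P Q : Prop} (h : P → Q) : ind P ≤ ind Q := by
  by_cases hP : P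
  · simp [hP, h hP]
  · simpa [hP] using ind_nonneg Q

/-- The probability of an event when each edge of `E` is retained with probability `p`. -/
noncomputable def prob (p : ℝ) (E : Finset (Sym2 V)) (A : Set (Sym2 V) → Prop) : ℝ :=
  mean p E (fun ω => ind (A ω))

variable {E : Finset (Sym2 V)} {A B C : Set (Sym2 V) → Prop}

lemma prob_nonneg (hp : p ∈ Set.Icc (0 : ℝ) 1) : 0 ≤ prob p E A :=
  mean_nonneg hp fun _ _ => ind_nonneg _

lemma prob_le_one (hp : p ∈ Set.Icc (0 : ℝ) 1) : prob p E A ≤ 1 := by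
  conv_rhs => rw [← mean_const (p := p) (E := E) 1]
  exact mean_mono hp fun _ _ => ind_le_one _

lemma prob_mono (hp : p ∈ Set.Icc (0 : ℝ) 1) (h : ∀ ω : Set (Sym2 V), ω ⊆ E → A ω → B ω) :
    prob p E A ≤ prob p E B :=
  mean_mono hp fun ω hω => ind_mono (h ω (by exact_mod_cast hω))

lemma prob_congr (h : ∀ ω : Set (Sym2 V), ω ⊆ E → (A ω ↔ B ω)) : prob p E A = prob p E B :=
  mean_congr fun ω hω => by rw [h ω (by exact_mod_cast hω)]

lemma prob_erase {e : Sym2 V} (he : e ∈ E) :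
    prob p E A =
      p * prob p (E.erase e) (fun ω => A (insert e ω)) + (1 - p) * prob p (E.erase e) A := by
  rw [prob, mean_erase he]
  simp only [prob, coe_insert]

lemma prob_and_not :
    prob p E (fun ω => A ω ∧ ¬ B ω) = prob p E A - prob p E (fun ω => A ω ∧ B ω) := by
  rw [prob, prob, prob, ← mean_sub]
  refine mean_congr fun ω _ => ?_
  by_cases hA : A ω <;> by_cases hB : B ω <;> simp [hA, hB]

lemma prob_const (P : Prop) : prob p E (fun _ => P) = ind P := mean_const _

lemma prob_mul : prob p E A * prob p E B =
    mean p E (fun a => mean p E (fun b => ind (A a) * ind (B b))) := by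
  simp only [prob, mean_mul_left, mean_mul_right]

/-- Consider a mixture of two measures with masses `z₁` and `z₀`. If two events are positively
correlated under both, and their conditional probabilities move in the same direction from one to
the other, then they are positively correlated under the mixture. -/
lemma mixture_correlation {z₀ z₁ a₀ a₁ b₀ b₁ c₀ c₁ : ℝ} (hp : p ∈ Set.Icc (0 : ℝ) 1)
    (hc₀ : 0 ≤ c₀) (hc₁ : 0 ≤ c₁) (ha₀ : 0 ≤ a₀) (ha₁ : 0 ≤ a₁) (hb₀ : 0 ≤ b₀) (hb₁ : 0 ≤ b₁)
    (haz₀ : a₀ ≤ z₀) (haz₁ : a₁ ≤ z₁) (hbz₀ : b₀ ≤ z₀) (hbz₁ : b₁ ≤ z₁)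
    (h₀ : a₀ * b₀ ≤ c₀ * z₀) (h₁ : a₁ * b₁ ≤ c₁ * z₁)
    (h : 0 ≤ (a₁ * z₀ - a₀ * z₁) * (b₁ * z₀ - b₀ * z₁)) :
    (p * a₁ + (1 - p) * a₀) * (p * b₁ + (1 - p) * b₀) ≤
      (p * c₁ + (1 - p) * c₀) * (p * z₁ + (1 - p) * z₀) := by
  have hp0 := hp.1
  have hp1 : 0 ≤ 1 - p := sub_nonneg.2 hp.2
  -- The `p * (1 - p)` coefficient. For positive masses it follows after multiplying by `z₀ * z₁`; a
  -- zero mass kills the left side.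
  have hcross : a₁ * b₀ + a₀ * b₁ ≤ c₁ * z₀ + c₀ * z₁ := by
    have hz₀ : 0 ≤ z₀ := ha₀.trans haz₀
    have hz₁ : 0 ≤ z₁ := ha₁.trans haz₁
    rcases hz₀.eq_or_lt with hz | hz₀'
    · obtain rfl : a₀ = 0 := by linarith
      obtain rfl : b₀ = 0 := by linarith
      have : 0 ≤ c₁ * z₀ + c₀ * z₁ := by positivity
      linarith
    rcases hz₁.eq_or_lt with hz | hz₁'
    · obtain rfl : a₁ = 0 := by linarith
      obtain rfl : b₁ = 0 := by linarith
      have : 0 ≤ c₁ * z₀ + c₀ * z₁ := by positivity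
      linarith
    refine le_of_mul_le_mul_right ?_ (mul_pos hz₀' hz₁')
    have e₀ := mul_le_mul_of_nonneg_right h₀ (sq_nonneg z₁)
    have e₁ := mul_le_mul_of_nonneg_right h₁ (sq_nonneg z₀)
    linarith [e₀, e₁, h]
  have e₀ := mul_le_mul_of_nonneg_left h₀ (mul_nonneg hp1 hp1)
  have e₁ := mul_le_mul_of_nonneg_left h₁ (mul_nonneg hp0 hp0)
  have e₂ := mul_le_mul_of_nonneg_left hcross (mul_nonneg hp0 hp1)
  linarith [e₀, e₁, e₂]

/-- Connections to the same set are positively correlated. -/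
theorem prob_joined_mul_le (hp : p ∈ Set.Icc (0 : ℝ) 1) (Y : Set V) (f g : V) :
    prob p E (Joined · Y f) * prob p E (Joined · Y g) ≤
      prob p E (fun ω => Joined ω Y f ∧ Joined ω Y g) := by
  induction E using Finset.strongInduction generalizing Y with
  | H E ih =>
  -- Reveal an edge at `Y`; when none is left, the events are deterministic.
  by_cases hE : ∃ u ∈ Y, ∃ v, s(u, v) ∈ E
  · obtain ⟨u, hu, v, he⟩ := hE
    have ih' := ih _ (erase_ssubset he)
    simp only [prob_erase he, joined_insert_edge hu]
    have hmono (w : V) : prob p (E.erase s(u, v)) (Joined · Y w) ≤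
        prob p (E.erase s(u, v)) (Joined · (insert v Y) w) :=
      prob_mono hp fun ω _ h => joined_insert.2 (.inr h)
    have key := mixture_correlation (z₀ := 1) (z₁ := 1) hp
      (prob_nonneg hp) (prob_nonneg hp) (prob_nonneg hp) (prob_nonneg hp) (prob_nonneg hp)
      (prob_nonneg hp) (prob_le_one hp) (prob_le_one hp) (prob_le_one hp) (prob_le_one hp)
      ((ih' Y).trans_eq (mul_one _).symm) ((ih' (insert v Y)).trans_eq (mul_one _).symm)
      (mul_nonneg (by linarith [hmono f]) (by linarith [hmono g]))
    linarith [key]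
  · push Not at hE
    have hmem (w : V) : ∀ ω : Set (Sym2 V), ω ⊆ E → (Joined ω Y w ↔ w ∈ Y) :=
      fun ω hω => joined_iff_mem fun a ha b hab => hE a ha b (by exact_mod_cast hω hab)
    rw [prob_congr (hmem f), prob_congr (hmem g),
      prob_congr fun ω hω => and_congr (hmem f ω hω) (hmem g ω hω)]
    simp only [prob_const]
    by_cases hf : f ∈ Y <;> by_cases hg : g ∈ Y <;> simp [hf, hg]

/-- Connections to the same set are positively correlated, also given the
separation of that set from another one. -/
theorem prob_separated_joined_mul_le (hp : p ∈ Set.Icc (0 : ℝ) 1) (X Y : Set V) (f g : V) :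
    prob p E (fun ω => Separated ω X Y ∧ Joined ω Y f) *
        prob p E (fun ω => Separated ω X Y ∧ Joined ω Y g) ≤
      prob p E (fun ω => Separated ω X Y ∧ Joined ω Y f ∧ Joined ω Y g) *
        prob p E (Separated · X Y) := by
  induction E using Finset.strongInduction generalizing X f g with
  | H E ih =>
  by_cases hE : ∃ u ∈ X, ∃ v, s(u, v) ∈ E
  · obtain ⟨u, hu, v, he⟩ := hE
    have ih' := ih _ (erase_ssubset he)
    have hone (w : V) (ω : Set (Sym2 V)) :
        (Separated (insert s(u, v) ω) X Y ∧ Joined (insert s(u, v) ω) Y w) ↔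
          Separated ω (insert v X) Y ∧ Joined ω Y w :=
      separated_joined_insert_edge hu (· w)
    have htwo (ω : Set (Sym2 V)) :
        (Separated (insert s(u, v) ω) X Y ∧ Joined (insert s(u, v) ω) Y f ∧
            Joined (insert s(u, v) ω) Y g) ↔
          Separated ω (insert v X) Y ∧ Joined ω Y f ∧ Joined ω Y g :=
      separated_joined_insert_edge hu (fun J => J f ∧ J g)
    simp only [prob_erase he, hone, htwo]
    simp only [separated_insert_edge hu]
    -- Retaining the edge lowers the conditional probability of reaching `w` from `Y`: it
    -- additionally conditions on `v` not being joined to `Y`, so the claim is the induction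
    -- hypothesis for `w` and `v`.
    have hdir (w : V) :
        prob p (E.erase s(u, v)) (fun ω => Separated ω (insert v X) Y ∧ Joined ω Y w) *
          prob p (E.erase s(u, v)) (Separated · X Y) ≤
        prob p (E.erase s(u, v)) (fun ω => Separated ω X Y ∧ Joined ω Y w) *
          prob p (E.erase s(u, v)) (Separated · (insert v X) Y) := by
      have := ih' X w v
      simp only [separated_insert, and_right_comm (c := Joined _ Y w), prob_and_not]
      simp only [and_assoc]
      linarith
    refine mixture_correlation hp (prob_nonneg hp) (prob_nonneg hp) (prob_nonneg hp)
      (prob_nonneg hp) (prob_nonneg hp) (prob_nonneg hp) ?_ ?_ ?_ ?_ (ih' X f g)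
      (ih' (insert v X) f g)
      (mul_nonneg_of_nonpos_of_nonpos (by linarith [hdir f]) (by linarith [hdir g]))
    all_goals exact prob_mono hp fun _ _ h => h.1
  · push Not at hE
    have hsep : ∀ ω : Set (Sym2 V), ω ⊆ E → (Separated ω X Y ↔ ∀ y ∈ Y, y ∉ X) :=
      fun ω hω => forall₂_congr fun y _ => not_congr <|
        joined_iff_mem fun a ha b hab => hE a ha b (by exact_mod_cast hω hab)
    rw [prob_congr hsep, prob_congr fun ω hω => and_congr_left' (hsep ω hω),
      prob_congr fun ω hω => and_congr_left' (hsep ω hω),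
      prob_congr fun ω hω => and_congr_left' (hsep ω hω)]
    by_cases h : ∀ y ∈ Y, y ∉ X
    · simpa only [eq_true h, true_and, prob_const, ind_true, mul_one] using
        prob_joined_mul_le (E := E) hp Y f g
    · simp [eq_false h, prob_const]

/-- Given that `X` and `Y` are separated, connection to `X` and non-connection to `Y` are
positively correlated. -/
theorem prob_separated_joined_mul_le_not_joined (hp : p ∈ Set.Icc (0 : ℝ) 1) (X Y : Set V)
    (s f : V) :
    prob p E (fun ω => Separated ω X Y ∧ Joined ω X s) *
        prob p E (fun ω => Separated ω X Y ∧ ¬ Joined ω Y f) ≤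
      prob p E (fun ω => Separated ω X Y ∧ Joined ω X s ∧ ¬ Joined ω Y f) *
        prob p E (Separated · X Y) := by
  induction E using Finset.strongInduction generalizing X f with
  | H E ih =>
  by_cases hE : ∃ u ∈ X, ∃ v, s(u, v) ∈ E
  · obtain ⟨u, hu, v, he⟩ := hE
    have ih' := ih _ (erase_ssubset he)
    have hone (ω : Set (Sym2 V)) :
        (Separated (insert s(u, v) ω) X Y ∧ ¬ Joined (insert s(u, v) ω) Y f) ↔
          Separated ω (insert v X) Y ∧ ¬ Joined ω Y f :=
      separated_joined_insert_edge hu (¬ · f)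
    have hjoint (ω : Set (Sym2 V)) :
        (Separated (insert s(u, v) ω) X Y ∧ Joined (insert s(u, v) ω) X s ∧
          ¬ Joined (insert s(u, v) ω) Y f) ↔
        Separated ω (insert v X) Y ∧ Joined ω (insert v X) s ∧ ¬ Joined ω Y f := by
      rw [and_left_comm, hone, joined_insert_edge hu, and_left_comm]
    simp only [prob_erase he, hjoint, hone]
    simp only [separated_insert_edge hu, joined_insert_edge hu]
    -- Retaining the edge raises both conditional probabilities. Here this is the induction
    -- hypothesis at `v`, together with the growth of `X`; for `f` it is the positive correlation of
    -- `f` and `v` being joined to `Y`.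
    have hdirs : prob p (E.erase s(u, v)) (fun ω => Separated ω X Y ∧ Joined ω X s) *
          prob p (E.erase s(u, v)) (Separated · (insert v X) Y) ≤
        prob p (E.erase s(u, v))
            (fun ω => Separated ω (insert v X) Y ∧ Joined ω (insert v X) s) *
          prob p (E.erase s(u, v)) (Separated · X Y) := by
      simp only [separated_insert]
      refine (ih' X v).trans (mul_le_mul_of_nonneg_right (prob_mono hp fun ω _ h => ?_)
        (prob_nonneg hp))
      exact ⟨⟨h.1, h.2.2⟩, joined_insert.2 (.inr h.2.1)⟩
    have hdirf : prob p (E.erase s(u, v)) (fun ω => Separated ω X Y ∧ ¬ Joined ω Y f) *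
          prob p (E.erase s(u, v)) (Separated · (insert v X) Y) ≤
        prob p (E.erase s(u, v)) (fun ω => Separated ω (insert v X) Y ∧ ¬ Joined ω Y f) *
          prob p (E.erase s(u, v)) (Separated · X Y) := by
      have := prob_separated_joined_mul_le (E := E.erase s(u, v)) hp X Y f v
      have hcomm : prob p (E.erase s(u, v))
          (fun ω => (Separated ω X Y ∧ ¬ Joined ω Y v) ∧ Joined ω Y f) =
          prob p (E.erase s(u, v)) (fun ω => Separated ω X Y ∧ Joined ω Y f) -
          prob p (E.erase s(u, v)) (fun ω => Separated ω X Y ∧ Joined ω Y f ∧ Joined ω Y v) := by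
        rw [prob_congr (B := fun ω => (Separated ω X Y ∧ Joined ω Y f) ∧ ¬ Joined ω Y v)
          (fun ω _ => and_right_comm), prob_and_not]
        simp only [and_assoc]
      simp only [separated_insert]
      rw [prob_and_not (A := fun ω => Separated ω X Y ∧ ¬ Joined ω Y v), hcomm, prob_and_not,
        prob_and_not]
      linarith
    refine mixture_correlation hp (prob_nonneg hp) (prob_nonneg hp) (prob_nonneg hp)
      (prob_nonneg hp) (prob_nonneg hp) (prob_nonneg hp) ?_ ?_ ?_ ?_ (ih' X f)
      (ih' (insert v X) f) (mul_nonneg (by linarith [hdirs]) (by linarith [hdirf]))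
    all_goals exact prob_mono hp fun _ _ h => h.1
  · push Not at hE
    have hmem : ∀ ω : Set (Sym2 V), ω ⊆ E → (Joined ω X s ↔ s ∈ X) :=
      fun ω hω => joined_iff_mem fun a ha b hab => hE a ha b (by exact_mod_cast hω hab)
    rw [prob_congr fun ω hω => and_congr_right' (hmem ω hω),
      prob_congr fun ω hω => and_congr_right' (and_congr_left' (hmem ω hω))]
    by_cases h : s ∈ X
    · simp [h, mul_comm]
    · simp [h, prob_const]

/-- Given that `X` and `Y` are separated, connections to `X` and to `Y` are negatively
correlated. -/
theorem prob_separated_mul_le (hp : p ∈ Set.Icc (0 : ℝ) 1) (X Y : Set V) (s f : V) :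
    prob p E (Separated · X Y) *
        prob p E (fun ω => Separated ω X Y ∧ Joined ω X s ∧ Joined ω Y f) ≤
      prob p E (fun ω => Separated ω X Y ∧ Joined ω X s) *
        prob p E (fun ω => Separated ω X Y ∧ Joined ω Y f) := by
  have h := prob_separated_joined_mul_le_not_joined (E := E) hp X Y s f
  simp only [← and_assoc, prob_and_not] at h ⊢
  -- Complementing the connection to `Y` reverses the sign of the correlation; the common product
  -- cancels.
  linarith

end Correlation

/-! ### Two layers glued along two vertices -/

section TwoLayers

variable {V : Type*} [DecidableEq V] {p : ℝ} {E : Finset (Sym2 V)}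

/-- Here `A`, `B` join `s` to `x`, `y` in one layer and `C`, `D` join `f` to `x`, `y` in the other.
The two subtracted products are mutually exclusive, and each excludes the event on the left while
implying `S` and `F`. -/
lemma ind_layer_one_le {A B C D N₁ N₂ S F : Prop} (hAB : A → B → ¬ N₁) (hCD : C → D → ¬ N₂)
    (hS : S ↔ A ∨ B) (hF : F ↔ C ∨ D) :
    ind (A ∧ C ∨ B ∧ D) ≤
      ind S * ind F - ind (N₁ ∧ A) * ind (N₂ ∧ D) - ind (N₁ ∧ B) * ind (N₂ ∧ C) := by
  by_cases hA : A <;> by_cases hB : B <;> by_cases hC : C <;> by_cases hD : D <;>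
    by_cases h₁ : N₁ <;> by_cases h₂ : N₂ <;> simp_all

/-- All letters but `N₂` and `Q` now refer to one layer, with `J` joining `s` to `f` there. Under
`N₁` the two mixed cases exclude each other and `J`, so the indicators on the left add up to at most
one. -/
lemma le_ind_layer_zero {A B C D N₁ N₂ Q J : Prop} (hAB : A → B → ¬ N₁) (hCD : C → D → ¬ N₁)
    (hAC : A → J → C) (hBD : B → J → D) (hQ : N₂ ↔ ¬ Q) :
    ind J + (ind (N₁ ∧ A ∧ D) + ind (N₁ ∧ C ∧ B)) * (1 - ind N₂) ≤
      ind (J ∨ Q ∧ (A ∧ D ∨ B ∧ C)) := by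
  by_cases hA : A <;> by_cases hB : B <;> by_cases hC : C <;> by_cases hD : D <;>
    by_cases h₁ : N₁ <;> by_cases h₂ : Q <;> by_cases hJ : J <;> simp_all

/-- In a single layer, if `s` and `f` are both joined to `{x, y}`, they share a cluster or hang on
different, separated ends. -/
lemma ind_both_le {A B C D N S F J : Prop} (hAC : A → C → J) (hBD : B → D → J)
    (hAD : A → D → ¬ N → J) (hBC : B → C → ¬ N → J) (hS : S ↔ A ∨ B) (hF : F ↔ C ∨ D) :
    ind (S ∧ F) ≤ ind J + ind (N ∧ A ∧ D) + ind (N ∧ C ∧ B) := by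
  by_cases hA : A <;> by_cases hB : B <;> by_cases hC : C <;> by_cases hD : D <;>
    by_cases h₁ : N <;> by_cases hJ : J <;> simp_all

/-- Let `a` and `b` be two independent percolations on the same graph, glued along `x` and `y`.
A vertex `s` in the layer of `a` is connected to `f` in its own layer at least as likely as to
`f` in the layer of `b`. -/
theorem two_layers_le (hp : p ∈ Set.Icc (0 : ℝ) 1) (x y s f : V) :
    mean p E (fun a => mean p E (fun b =>
      ind ((Joined a {x} s ∧ Joined b {x} f) ∨ (Joined a {y} s ∧ Joined b {y} f)))) ≤
    mean p E (fun a => mean p E (fun b =>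
      ind (Joined a {s} f ∨ (Joined b {x} y ∧ ((Joined a {x} s ∧ Joined a {y} f) ∨
        (Joined a {y} s ∧ Joined a {x} f)))))) := by
  set N : Set (Sym2 V) → Prop := (Separated · {x} {y})
  have hN (ω : Set (Sym2 V)) : N ω ↔ ¬ Joined ω {x} y := by simp [N, Separated]
  have hxy {ω : Set (Sym2 V)} {v : V} (h₁ : Joined ω {x} v) (h₂ : Joined ω {y} v) :
      Joined ω {x} y := h₁.trans (joined_singleton.1 h₂).symm
  have hsf {ω : Set (Sym2 V)} {u : V} (h₁ : Joined ω {u} s) (h₂ : Joined ω {u} f) :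
      Joined ω {s} f := joined_singleton.2 ((joined_singleton.1 h₁).symm.trans
        (joined_singleton.1 h₂))
  have hfx {ω : Set (Sym2 V)} {u : V} (h₁ : Joined ω {u} s) (h₂ : Joined ω {s} f) :
      Joined ω {u} f := h₁.trans (joined_singleton.1 h₂)
  have hpair {ω : Set (Sym2 V)} {v : V} :
      Joined ω {x, y} v ↔ Joined ω {x} v ∨ Joined ω {y} v := by
    rw [joined_pair, joined_singleton, joined_singleton]
  have hx_of_y {ω : Set (Sym2 V)} {v : V} (h₁ : Joined ω {x} y) (h₂ : Joined ω {y} v) :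
      Joined ω {x} v := h₁.trans (joined_singleton.1 h₂)
  have hupper : mean p E (fun a => mean p E (fun b =>
      ind ((Joined a {x} s ∧ Joined b {x} f) ∨ (Joined a {y} s ∧ Joined b {y} f)))) ≤
      prob p E (Joined · {x, y} s) * prob p E (Joined · {x, y} f) -
        prob p E (fun ω => N ω ∧ Joined ω {x} s) * prob p E (fun ω => N ω ∧ Joined ω {y} f) -
        prob p E (fun ω => N ω ∧ Joined ω {y} s) * prob p E (fun ω => N ω ∧ Joined ω {x} f) := by
    simp only [prob_mul, ← mean_sub]
    refine mean_mono hp fun a _ => mean_mono hp fun b _ => ?_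
    exact ind_layer_one_le (fun h₁ h₂ h => (hN _).1 h (hxy h₁ h₂))
      (fun h₁ h₂ h => (hN _).1 h (hxy h₁ h₂)) hpair hpair
  have hlower : prob p E (Joined · {s} f) +
      (prob p E (fun ω => N ω ∧ Joined ω {x} s ∧ Joined ω {y} f) +
        prob p E (fun ω => N ω ∧ Joined ω {x} f ∧ Joined ω {y} s)) * (1 - prob p E N) ≤
      mean p E (fun a => mean p E (fun b =>
        ind (Joined a {s} f ∨ (Joined b {x} y ∧ ((Joined a {x} s ∧ Joined a {y} f) ∨
          (Joined a {y} s ∧ Joined a {x} f)))))) := by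
    have hone : (1 : ℝ) - prob p E N = mean p E (fun ω => 1 - ind (N ω)) := by
      rw [mean_sub, mean_const, prob]
    rw [hone]
    simp only [prob, ← mean_add, ← mean_mul_right]
    refine mean_mono hp fun a _ => ?_
    rw [← mean_mul_left, ← mean_const (p := p) (E := E) (ind (Joined a {s} f)), ← mean_add]
    refine mean_mono hp fun b _ => ?_
    exact le_ind_layer_zero (fun h₁ h₂ h => (hN _).1 h (hxy h₁ h₂))
      (fun h₁ h₂ h => (hN _).1 h (hxy h₁ h₂)) hfx hfx (hN _)
  have hmid : prob p E (fun ω => Joined ω {x, y} s ∧ Joined ω {x, y} f) ≤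
      prob p E (Joined · {s} f) + prob p E (fun ω => N ω ∧ Joined ω {x} s ∧ Joined ω {y} f) +
        prob p E (fun ω => N ω ∧ Joined ω {x} f ∧ Joined ω {y} s) := by
    simp only [prob, ← mean_add]
    refine mean_mono hp fun a _ => ?_
    have hQ (h : ¬ N a) : Joined a {x} y := not_not.1 fun h' => h ((hN _).2 h')
    exact ind_both_le hsf hsf (fun h₁ h₂ h => hsf h₁ (hx_of_y (hQ h) h₂))
      (fun h₁ h₂ h => hsf (hx_of_y (hQ h) h₁) h₂) hpair hpair
  have hharris := prob_joined_mul_le (E := E) hp {x, y} s f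
  have hneg₁ := prob_separated_mul_le (E := E) hp {x} {y} s f
  have hneg₂ := prob_separated_mul_le (E := E) hp {x} {y} f s
  linarith

end TwoLayers

/-! ### Configurations of the bunk bed graph -/

section Graph

variable {V : Type*} {a b : Set (Sym2 V)} {x y s f : V}

/-- The configuration of the bunk bed graph with edges `a` in the layer `0`, edges `b` in the
layer `1`, and outside edges over `c`. -/
def glue (a b : Set (Sym2 V)) (c : Set V) : Set (Sym2 (V × Fin 2)) :=
  (fun v => s((v, 0), (v, 1))) '' c ∪
    (Sym2.map (fun v => (v, 0)) '' a ∪ Sym2.map (fun v => (v, 1)) '' b)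

lemma outside_glue (c : Set V) : outside (glue a b c) = c := by
  ext v
  have h (i : Fin 2) (e : Sym2 V) : Sym2.map (fun v => (v, i)) e ≠ s((v, 0), (v, 1)) := by
    induction e with | _ u w =>
    fin_cases i <;> simp
  simp [outside, glue, h]

lemma edge_zero_mem_glue {u v : V} {c : Set V} (h : s(u, v) ∈ a) :
    s((u, 0), (v, 0)) ∈ glue a b c := .inr (.inl ⟨_, h, rfl⟩)

lemma edge_one_mem_glue {u v : V} {c : Set V} (h : s(u, v) ∈ b) :
    s((u, 1), (v, 1)) ∈ glue a b c := .inr (.inr ⟨_, h, rfl⟩)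

lemma post_mem_glue {v : V} {c : Set V} (h : v ∈ c) :
    s((v, 0), (v, 1)) ∈ glue a b c := .inl ⟨_, h, rfl⟩

lemma Joined.zero {u v : V} {c : Set V} {Z : Set (V × Fin 2)} (h : Joined a {u} v)
    (hu : Joined (glue a b c) Z (u, 0)) : Joined (glue a b c) Z (v, 0) :=
  h.induct (P := fun w => Joined (glue a b c) Z (w, 0)) (by simpa using hu)
    fun _ _ hw he => hw.step (edge_zero_mem_glue he)

lemma Joined.one {u v : V} {c : Set V} {Z : Set (V × Fin 2)} (h : Joined b {u} v)
    (hu : Joined (glue a b c) Z (u, 1)) : Joined (glue a b c) Z (v, 1) :=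
  h.induct (P := fun w => Joined (glue a b c) Z (w, 1)) (by simpa using hu)
    fun _ _ hw he => hw.step (edge_one_mem_glue he)

lemma Joined.swap {u v : V} (h : Joined a {u} v) : Joined a {v} u :=
  joined_singleton.2 (joined_singleton.1 h).symm

lemma joined_glue_zero (h : Joined a {s} f ∨ (Joined b {x} y ∧ ((Joined a {x} s ∧ Joined a {y} f) ∨
    (Joined a {y} s ∧ Joined a {x} f)))) :
    Joined (glue a b {x, y}) {(s, 0)} (f, 0) := by
  have hs : Joined (glue a b {x, y}) {(s, 0)} (s, 0) := joined_of_mem rfl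
  have hup {v : V} (hv : v ∈ ({x, y} : Set V)) (h : Joined (glue a b {x, y}) {(s, 0)} (v, 0)) :
      Joined (glue a b {x, y}) {(s, 0)} (v, 1) := h.step (post_mem_glue hv)
  have hdown {v : V} (hv : v ∈ ({x, y} : Set V)) (h : Joined (glue a b {x, y}) {(s, 0)} (v, 1)) :
      Joined (glue a b {x, y}) {(s, 0)} (v, 0) :=
    h.step (by rw [Sym2.eq_swap]; exact post_mem_glue hv)
  rcases h with h | ⟨hxy, ⟨hs', hf⟩ | ⟨hs', hf⟩⟩
  · exact h.zero hs
  · exact hf.zero (hdown (by simp) (hxy.one (hup (by simp) (hs'.swap.zero hs))))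
  · exact hf.zero (hdown (by simp) (hxy.swap.one (hup (by simp) (hs'.swap.zero hs))))

/-- With only two outside edges, a path ending in layer 1 can be shortened to cross between layers
once. -/
lemma joined_glue_one (h : Joined (glue a b {x, y}) {(s, 0)} (f, 1)) :
    (Joined a {x} s ∧ Joined b {x} f) ∨ (Joined a {y} s ∧ Joined b {y} f) := by
  -- An invariant closed under every retained edge: layer 0 is reached directly or by a single round
  -- trip through layer 1, layer 1 by a single crossing.
  let P : V × Fin 2 → Prop := fun w =>
    if w.2 = 0 then Joined a {s} w.1 ∨ (Joined a {x} s ∧ Joined b {x} y ∧ Joined a {y} w.1) ∨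
        (Joined a {y} s ∧ Joined b {y} x ∧ Joined a {x} w.1)
      else (Joined a {x} s ∧ Joined b {x} w.1) ∨ (Joined a {y} s ∧ Joined b {y} w.1)
  refine h.induct (P := P) (by rintro _ rfl; exact .inl (joined_of_mem rfl)) ?_
  have hrefl {ω : Set (Sym2 V)} {v : V} : Joined ω {v} v := joined_of_mem rfl
  rintro u w hu (⟨v, hv, he⟩ | ⟨e, hea, he⟩ | ⟨e, heb, he⟩)
  · rcases Sym2.eq_iff.1 he with ⟨rfl, rfl⟩ | ⟨rfl, rfl⟩
    · simp only [P, if_true] at hu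
      simp only [P, one_ne_zero, if_false]
      rcases hv with rfl | rfl
      · rcases hu with h | ⟨h, _, _⟩ | ⟨h₁, h₂, _⟩
        · exact .inl ⟨h.swap, hrefl⟩
        · exact .inl ⟨h, hrefl⟩
        · exact .inr ⟨h₁, h₂⟩
      · rcases hu with h | ⟨h₁, h₂, _⟩ | ⟨h, _, _⟩
        · exact .inr ⟨h.swap, hrefl⟩
        · exact .inl ⟨h₁, h₂⟩
        · exact .inr ⟨h, hrefl⟩
    · simp only [P, one_ne_zero, if_false] at hu
      simp only [P, if_true]
      rcases hv with rfl | rfl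
      · rcases hu with ⟨h, _⟩ | ⟨h₁, h₂⟩
        · exact .inl h.swap
        · exact .inr (.inr ⟨h₁, h₂, hrefl⟩)
      · rcases hu with ⟨h₁, h₂⟩ | ⟨h, _⟩
        · exact .inr (.inl ⟨h₁, h₂, hrefl⟩)
        · exact .inl h.swap
  · induction e with | _ c d =>
    have hstep {c d : V} (he : s(c, d) ∈ a) (hu : P (c, 0)) : P (d, 0) := by
      simp only [P, if_true] at hu ⊢
      exact hu.imp (·.step he) (.imp (.imp_right (.imp_right (·.step he)))
        (.imp_right (.imp_right (·.step he))))
    rcases Sym2.eq_iff.1 he with ⟨rfl, rfl⟩ | ⟨rfl, rfl⟩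
    · exact hstep hea hu
    · exact hstep (Sym2.eq_swap ▸ hea) hu
  · induction e with | _ c d =>
    have hstep {c d : V} (he : s(c, d) ∈ b) (hu : P (c, 1)) : P (d, 1) := by
      simp only [P, one_ne_zero, if_false] at hu ⊢
      exact hu.imp (.imp_right (·.step he)) (.imp_right (·.step he))
    rcases Sym2.eq_iff.1 he with ⟨rfl, rfl⟩ | ⟨rfl, rfl⟩
    · exact hstep heb hu
    · exact hstep (Sym2.eq_swap ▸ heb) hu

end Graph

/-! ### The law of the percolation -/

section Law

/-- The measure is carried by the finitely many subsets of `u`, so an event is measured by summing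
atoms. -/
lemma setBernoulli_real_eq_mean {α : Type*} [Finite α] [DecidableEq α] (u : Finset α)
    (p : unitInterval) (A : Set (Set α)) :
    (setBernoulli (u : Set α) p).real A = mean p u (fun ω => ind ((ω : Set α) ∈ A)) := by
  classical
  let U : Finset (Finset α) := u.powerset.filter (fun ω => (ω : Set α) ∈ A)
  have hA : setBernoulli (u : Set α) p A =
      setBernoulli (u : Set α) p (⋃ ω ∈ U, {(ω : Set α)}) := by
    rw [setBernoulli_apply_eq_apply_subsets]
    congr 1
    ext t
    simp only [U, Set.mem_ofPred_eq, mem_filter, mem_powerset, Set.mem_iUnion,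
      Set.mem_singleton_iff, exists_prop]
    constructor
    · rintro ⟨ht, htu⟩
      lift t to Finset α using t.toFinite
      exact ⟨t, ⟨by exact_mod_cast htu, ht⟩, rfl⟩
    · rintro ⟨ω, ⟨h₁, h₂⟩, rfl⟩
      exact ⟨h₂, by exact_mod_cast h₁⟩
  rw [measureReal_def, hA, ← measureReal_def,
    measureReal_biUnion_finset (by simp [Set.PairwiseDisjoint, Set.Pairwise]) (by simp),
    sum_filter, mean]
  refine sum_congr rfl fun ω hω => ?_
  rw [mem_powerset] at hω
  split_ifs with h
  · rw [setBernoulli_real_singleton p (by exact_mod_cast hω) u.finite_toSet,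
      ← coe_sdiff, Set.ncard_coe_finset, Set.ncard_coe_finset, eq_true h, ind_true, mul_one]
  · simp [h]

variable {V : Type*}

lemma mk_mem_map_layer {A : Set (Sym2 V)} {u w : V} {i j k : Fin 2} :
    s((u, j), (w, k)) ∈ Sym2.map (fun v => (v, i)) '' A ↔ s(u, w) ∈ A ∧ j = i ∧ k = i := by
  constructor
  · rintro ⟨e, he, h⟩
    induction e with | _ c d =>
    rcases Sym2.eq_iff.1 h with ⟨h₁, h₂⟩ | ⟨h₁, h₂⟩ <;> cases h₁ <;> cases h₂
    · exact ⟨he, rfl, rfl⟩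
    · exact ⟨Sym2.eq_swap ▸ he, rfl, rfl⟩
  · rintro ⟨h, rfl, rfl⟩
    exact ⟨_, h, rfl⟩

lemma edgeSet_graph (G : SimpleGraph V) :
    (graph G).edgeSet = glue G.edgeSet G.edgeSet Set.univ := by
  ext e
  induction e with | _ u w =>
  obtain ⟨u, i⟩ := u
  obtain ⟨w, j⟩ := w
  simp only [glue, Set.mem_union, mk_mem_map_layer, graph, SimpleGraph.mem_edgeSet,
    SimpleGraph.boxProd_adj, SimpleGraph.top_adj]
  fin_cases i <;> fin_cases j <;> simp [eq_comm]

variable [Fintype V] [DecidableEq V]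

/-- The outside edges and the two layers are pairwise disjoint edge sets, hence independent. -/
lemma percolation_real_eq_mean (G : SimpleGraph V) [DecidableRel G.Adj] (p : unitInterval)
    (A : Set (Set (Sym2 (V × Fin 2)))) :
    (percolation G p).real A = mean p (univ : Finset V) (fun c => mean p G.edgeFinset (fun a =>
      mean p G.edgeFinset (fun b => ind (glue a b c ∈ A)))) := by
  have hE : (graph G).edgeSet = ((univ.image (fun v : V => s((v, 0), (v, 1))) ∪
      (G.edgeFinset.image (Sym2.map (fun v => (v, 0))) ∪
        G.edgeFinset.image (Sym2.map (fun v => (v, 1)))) : Finset (Sym2 (V × Fin 2))) :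
        Set (Sym2 (V × Fin 2))) := by
    simp [edgeSet_graph, glue]
  have hinj (i : Fin 2) : Function.Injective (Sym2.map (fun v : V => (v, i))) :=
    Sym2.map.injective fun _ _ h => congrArg Prod.fst h
  have hpost : Function.Injective (fun v : V => s((v, (0 : Fin 2)), (v, (1 : Fin 2)))) := by
    intro v w h
    simpa using h
  have hd₁ : Disjoint (univ.image (fun v : V => s((v, (0 : Fin 2)), (v, (1 : Fin 2)))))
      (G.edgeFinset.image (Sym2.map (fun v => (v, 0))) ∪
        G.edgeFinset.image (Sym2.map (fun v => (v, 1)))) := by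
    rw [← disjoint_coe]
    simp only [coe_union, coe_image, Set.disjoint_left]
    rintro _ ⟨v, _, rfl⟩ h
    simp only [Set.mem_union, mk_mem_map_layer] at h
    simp at h
  have hd₂ : Disjoint (G.edgeFinset.image (Sym2.map (fun v => (v, (0 : Fin 2)))))
      (G.edgeFinset.image (Sym2.map (fun v => (v, (1 : Fin 2))))) := by
    rw [← disjoint_coe]
    simp only [coe_image, Set.disjoint_left]
    intro e h₀ h₁
    induction e with | _ u w =>
    obtain ⟨u, i⟩ := u
    obtain ⟨w, j⟩ := w
    rw [mk_mem_map_layer] at h₀ h₁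
    exact zero_ne_one (h₀.2.1.symm.trans h₁.2.1)
  rw [percolation, hE, setBernoulli_real_eq_mean, mean_union hd₁, mean_image hpost]
  refine mean_congr fun c _ => ?_
  rw [mean_union hd₂, mean_image (hinj 0)]
  refine mean_congr fun a _ => ?_
  rw [mean_image (hinj 1)]
  refine mean_congr fun b _ => ?_
  simp only [glue, coe_union, coe_image]

/-- On an event that depends only on the outside edges and prescribes that there are two of them,
the vertex `(s, 0)` is connected to `(f, 0)` at least as likely as to `(f, 1)`. -/
lemma percolation_outside_inter_connected_le (G : SimpleGraph V) (p : unitInterval) (s f : V)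
    (𝒳 : Set (Set V)) (h𝒳 : ∀ X ∈ 𝒳, X.ncard = 2) :
    percolation G p ({ω | outside ω ∈ 𝒳} ∩ connected (s, 0) (f, 1)) ≤
      percolation G p ({ω | outside ω ∈ 𝒳} ∩ connected (s, 0) (f, 0)) := by
  classical
  have hprob : IsProbabilityMeasure (percolation G p) := by
    unfold percolation
    infer_instance
  rw [← ENNReal.toReal_le_toReal (measure_ne_top _ _) (measure_ne_top _ _)]
  change (percolation G p).real _ ≤ (percolation G p).real _
  rw [percolation_real_eq_mean, percolation_real_eq_mean]
  refine mean_mono p.2 fun c _ => ?_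
  simp only [Set.mem_inter_iff, Set.mem_ofPred_eq, outside_glue]
  by_cases hc : (c : Set V) ∈ 𝒳
  · obtain ⟨x, y, -, hxy⟩ := Set.ncard_eq_two.1 (h𝒳 _ hc)
    simp only [hc, true_and]
    simp only [hxy]
    refine le_trans ?_ ((two_layers_le (E := G.edgeFinset) p.2 x y s f).trans ?_)
    · refine mean_mono p.2 fun a _ => mean_mono p.2 fun b _ => ?_
      have := joined_glue_one (a := a) (b := b) (x := x) (y := y) (s := s) (f := f)
      rw [joined_singleton] at this
      exact ind_mono this
    · refine mean_mono p.2 fun a _ => mean_mono p.2 fun b _ => ?_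
      have := joined_glue_zero (a := a) (b := b) (x := x) (y := y) (s := s) (f := f)
      rw [joined_singleton (u := (s, (0 : Fin 2)))] at this
      exact ind_mono this
  · simp [hc]

end Law
end BunkBed

theorem mainTheorem1 {V : Type*} [Finite V] (G : SimpleGraph V) (p : unitInterval) (s f : V) :
    (∀ X : Set V, X.ncard = 2 →
      ProbabilityTheory.cond (BunkBed.percolation G p) {ω | BunkBed.outside ω = X}
          (BunkBed.connected (s, 0) (f, 1)) ≤
        ProbabilityTheory.cond (BunkBed.percolation G p) {ω | BunkBed.outside ω = X}
          (BunkBed.connected (s, 0) (f, 0))) ∧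
    ProbabilityTheory.cond (BunkBed.percolation G p) {ω | (BunkBed.outside ω).ncard = 2}
        (BunkBed.connected (s, 0) (f, 1)) ≤
      ProbabilityTheory.cond (BunkBed.percolation G p) {ω | (BunkBed.outside ω).ncard = 2}
        (BunkBed.connected (s, 0) (f, 0)) := by
  classical
  have := Fintype.ofFinite V
  have hmeas (A : Set (Set (Sym2 (V × Fin 2)))) : MeasurableSet A := A.toFinite.measurableSet
  refine ⟨fun X hX => ?_, ?_⟩ <;>
    rw [ProbabilityTheory.cond_apply (hmeas _), ProbabilityTheory.cond_apply (hmeas _)]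
  -- Both sides carry the same factor, the inverse mass of the conditioning event. If that mass is
  -- zero, both conditional probabilities are zero, so no positivity is needed.
  · exact mul_le_mul_right (BunkBed.percolation_outside_inter_connected_le G p s f {X}
      (by rintro _ rfl; exact hX)) _
  · exact mul_le_mul_right (BunkBed.percolation_outside_inter_connected_le G p s f
      {X | X.ncard = 2} fun _ => id) _
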